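/- **IV model.** Let $r,q,d,p\ge 0$ be integers. Let $\epsilon_Z\in\mathbb{R}^r$, $\epsilon_U\in\mathbb{R}^q$, $\epsilon_X$, $\epsilon_Y$ be jointly independent noise variables, and let $$Z:=\epsilon_Z,\qquad U:=\epsilon_U,\qquad X:=g^0(Z,U,\epsilon_X)\in\mathbb{R}^d,\qquad Y:=f^0(X)+h^0(U,\epsilon_Y)\in\mathbb{R},$$ with measurable $f^0,g^0,h^0$ and $\mathbb{E}[\epsilon_Z]=\mathbb{E}[X]=\mathbb{E}[h^0(U,\epsilon_Y)]=0$ (all three integrable). Write $\mathbb{P}_{M^0}$ for the law of $(X,Y,Z)$. Assume that $f^0(\cdot)=\phi(\cdot)^\top\theta^0$ for a bounded measurable function $\phi:\mathbb{R}^d\to\mathbb{R}^p$ and some $\theta^0\in\Theta$, where $\Theta\subseteq\mathbb{R}^p$ is compact, and assume the identifiability condition: for all $\tau\in\mathbb{R}^p$, $$Z\perp\!\!\!\perp h^0(U,\epsilon_Y)+\phi(X)^\top\tau\quad\Longrightarrow\quad\tau=0.$$ Let $(X_i,Y_i,Z_i)_{i\ge1}$ be i.i.d. with law $\mathbb{P}_{M^0}$,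 let $\mathcal{D}_n=(X_i,Y_i,Z_i)_{i=1}^n$, and let $\mathcal{F}:=\{\phi(\cdot)^\top\theta\mid\theta\in\Theta\}$. **Theorem 1.** (a) Let $k_R:\mathbb{R}\times\mathbb{R}\to\mathbb{R}$ and $k_Z:\mathbb{R}^r\times\mathbb{R}^r\to\mathbb{R}$ be fixed positive definite kernels that are bounded, continuously differentiable, have bounded derivatives, and are characteristic (that is, $P\mapsto\int k(x,\cdot)\,dP(x)$ is injective on Borel probability measures). For $f\in\mathcal{F}$ put $$\widehat{\operatorname{HSIC}}_n(f):=\operatorname{trace}(KHLH),\quad K_{ij}=k_R\big(Y_i-f(X_i),Y_j-f(X_j)\big),\quad L_{ij}=k_Z(Z_i,Z_j),\quad H_{ij}=\delta_{ij}-\tfrac1n .$$ Then a minimizer of $\widehat{\operatorname{HSIC}}_n$ over $\mathcal{F}$ exists for every data set, and every choice of minimizers $\hat f_n\in\operatorname{argmin}_{f\in\mathcal{F}}\widehat{\operatorname{HSIC}}_n(f)$ is consistent: $\|\hat f_n-f^0\|_\infty=\sup_{x\in\mathbb{R}^d}|\hat f_n(x)-f^0(x)|\to0$ in probability as $n\to\infty$.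 (b) Let $H(\mathbb{P}_{M^0},\cdot):\Theta\to[0,\infty)$ be any independence measure and let $\hat H_n(\mathcal{D}_n,\cdot):\Theta\to\mathbb{R}$, $n\in\mathbb{N}$, be estimates of it based on the data, such that (i) for all $\theta\in\Theta$, $H(\mathbb{P}_{M^0},\theta)=0$ if and only if $Y-\phi(X)^\top\theta\perp\!\!\!\perp Z$; (ii) for all $\theta\in\Theta$, $\hat H_n(\mathcal{D}_n,\theta)\to H(\mathbb{P}_{M^0},\theta)$ in probability; (iii) there is a constant $L$ such that $\theta\mapsto H(\mathbb{P}_{M^0},\theta)$ and, for every $n$ and every data set, $\theta\mapsto\hat H_n(\mathcal{D}_n,\theta)$ are Lipschitz continuous on $\Theta$ with constant $L$. Then minimizers of $\hat H_n(\mathcal{D}_n,\cdot)$ over $\Theta$ exist for every data set, and for every choice $\hat\theta_n\in\operatorname{argmin}_{\theta\in\Theta}\hat H_n(\mathcal{D}_n,\theta)$ the functions $\hat f_n=\phi(\cdot)^\top\hat\theta_n$ satisfy $\|\hat f_n-f^0\|_\infty\to0$ in probability. (For events that are not measurable, probability means outer probability.) -/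

import Mathlib

open MeasureTheory ProbabilityTheory Filter Topology
open scoped ENNReal NNReal

noncomputable section

/-- `ℝᵏ` with its Euclidean norm. -/
abbrev RV (k : ℕ) : Type := EuclideanSpace ℝ (Fin k)

/-- An observation `(X, Y, Z)` with predictors `X ∈ ℝᵈ`, response `Y ∈ ℝ` and instruments
`Z ∈ ℝʳ`. -/
abbrev Obs (d r : ℕ) : Type := RV d × ℝ × RV r

/-- An IV model `M = (f, g, h, Q)`: the structural equations
`Z := ε_Z`, `U := ε_U`, `X := g (Z, U, ε_X)`, `Y := f X + h (U, ε_Y)`,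
where `ε_Z`, `ε_U`, `ε_X`, `ε_Y` are jointly independent with marginal laws `QZ`, `QU`, `QX`, `QY`
(so that `Q` is the product of these laws), and `ε_Z`, `X`, `h (U, ε_Y)` have mean zero. -/
structure IVModel (d r q : ℕ) (NX NY : Type*) [MeasurableSpace NX] [MeasurableSpace NY] where
  /-- the causal function -/
  f : RV d → ℝ
  /-- the mechanism of the predictors -/
  g : RV r × RV q × NX → RV d
  /-- the noise term of the response -/
  h : RV q × NY → ℝ
  QZ : Measure (RV r)
  QU : Measure (RV q)
  QX : Measure NX
  QY : Measure NY
  measurable_f : Measurable f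
  measurable_g : Measurable g
  measurable_h : Measurable h
  isProb_QZ : IsProbabilityMeasure QZ
  isProb_QU : IsProbabilityMeasure QU
  isProb_QX : IsProbabilityMeasure QX
  isProb_QY : IsProbabilityMeasure QY
  integrable_Z : Integrable (fun z => z) QZ
  mean_Z : ∫ z, z ∂QZ = 0
  integrable_X : Integrable g (QZ.prod (QU.prod QX))
  mean_X : ∫ e, g e ∂(QZ.prod (QU.prod QX)) = 0
  integrable_h : Integrable h (QU.prod QY)
  mean_h : ∫ e, h e ∂(QU.prod QY) = 0

namespace IVModel

/-- The joint law of the noise `(ε_Z, ε_U, ε_X, ε_Y)`. -/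
def Q {d r q : ℕ} {NX NY : Type*} [MeasurableSpace NX] [MeasurableSpace NY]
    (M : IVModel d r q NX NY) : Measure (RV r × RV q × NX × NY) :=
  M.QZ.prod (M.QU.prod (M.QX.prod M.QY))

/-- The instruments, as a function of the noise. -/
def Z {d r q : ℕ} {NX NY : Type*} [MeasurableSpace NX] [MeasurableSpace NY]
    (_M : IVModel d r q NX NY) (e : RV r × RV q × NX × NY) : RV r :=
  e.1

/-- The predictors, as a function of the noise. -/
def X {d r q : ℕ} {NX NY : Type*} [MeasurableSpace NX] [MeasurableSpace NY]
    (M : IVModel d r q NX NY) (e : RV r × RV q × NX × NY) : RV d :=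
  M.g (e.1, e.2.1, e.2.2.1)

/-- The term `h (U, ε_Y)`, as a function of the noise. -/
def hUY {d r q : ℕ} {NX NY : Type*} [MeasurableSpace NX] [MeasurableSpace NY]
    (M : IVModel d r q NX NY) (e : RV r × RV q × NX × NY) : ℝ :=
  M.h (e.2.1, e.2.2.2)

/-- The response, as a function of the noise. -/
def Y {d r q : ℕ} {NX NY : Type*} [MeasurableSpace NX] [MeasurableSpace NY]
    (M : IVModel d r q NX NY) (e : RV r × RV q × NX × NY) : ℝ :=
  M.f (M.X e) + M.hUY e

/-- The induced distribution of the observed variables `(X, Y, Z)`. -/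
def obsLaw {d r q : ℕ} {NX NY : Type*} [MeasurableSpace NX] [MeasurableSpace NY]
    (M : IVModel d r q NX NY) : Measure (Obs d r) :=
  M.Q.map (fun e => (M.X e, M.Y e, M.Z e))

/-- The identifiability condition: if `Z` is independent of `h (U, ε_Y) + φ(X)ᵀ τ`,
then `τ = 0`. -/
def Identifiable {d r q : ℕ} {NX NY : Type*} [MeasurableSpace NX] [MeasurableSpace NY]
    (M : IVModel d r q NX NY) {p : ℕ} (φ : RV d → RV p) : Prop :=
  ∀ τ : RV p, IndepFun M.Z (fun e => M.hUY e + inner ℝ (φ (M.X e)) τ) M.Q → τ = 0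

end IVModel

/-- The linear function `x ↦ φ(x)ᵀ θ`. -/
def linFun {d p : ℕ} (φ : RV d → RV p) (θ : RV p) : RV d → ℝ :=
  fun x => inner ℝ (φ x) θ

/-- The function class `{φ(·)ᵀ θ | θ ∈ Θ}`. -/
def funClass {d p : ℕ} (φ : RV d → RV p) (Θ : Set (RV p)) : Set (RV d → ℝ) :=
  {f | ∃ θ ∈ Θ, f = linFun φ θ}

/-- The supremum norm of `f - f'` (possibly infinite). -/
def supDist {d : ℕ} (f f' : RV d → ℝ) : ℝ≥0∞ :=
  ⨆ x, ENNReal.ofReal |f x - f' x|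

/-- `‖fₙ - f'‖_∞ → 0` in `P`-probability, for random functions `fₙ`. For sets that are not
measurable, `P` is the outer measure. -/
def SupConsistent {d : ℕ} {Ω : Type*} [MeasurableSpace Ω] (P : Measure Ω)
    (fhat : ℕ → Ω → RV d → ℝ) (f' : RV d → ℝ) : Prop :=
  ∀ ε : ℝ, 0 < ε →
    Tendsto (fun n => P {ω | ENNReal.ofReal ε ≤ supDist (fhat n ω) f'}) atTop (𝓝 0)

/-- The data set of the first `n` observations. -/
def sample {S Ω : Type*} (D : ℕ → Ω → S) (n : ℕ) (ω : Ω) : Fin n → S :=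
  fun i => D i ω

/-- Positive definite kernels: symmetric, with `∑ᵢ ∑ⱼ cᵢ cⱼ k (xᵢ, xⱼ) ≥ 0` for all finite
families. -/
def IsPDKernel {S : Type*} (k : S → S → ℝ) : Prop :=
  (Matrix.of k).PosSemidef

/-- Characteristic kernels: the kernel mean embedding `P ↦ ∫ k(x, ·) dP(x)` (an element of the
reproducing kernel Hilbert space of `k`, which is a space of functions) is injective on Borel
probability measures. The definition is meant for bounded measurable `k`, so that all these
integrals exist. -/
def IsCharacteristic {S : Type*} [MeasurableSpace S] (k : S → S → ℝ) : Prop :=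
  ∀ P P' : Measure S, IsProbabilityMeasure P → IsProbabilityMeasure P' →
    (∀ y, ∫ x, k x y ∂P = ∫ x, k x y ∂P') → P = P'

/-- Bounded, continuously differentiable, characteristic (positive definite) kernels with bounded
derivative. -/
structure IsAdmissibleKernel {S : Type*} [NormedAddCommGroup S] [NormedSpace ℝ S]
    [MeasurableSpace S] (k : S → S → ℝ) : Prop where
  posDef : IsPDKernel k
  bounded : ∃ C : ℝ, ∀ x y, |k x y| ≤ C
  contDiff : ContDiff ℝ 1 (fun v : S × S => k v.1 v.2)
  deriv_bounded : ∃ C : ℝ, ∀ v : S × S, ‖fderiv ℝ (fun v : S × S => k v.1 v.2) v‖ ≤ C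
  characteristic : IsCharacteristic k

/-- The empirical Hilbert-Schmidt independence criterion `trace (K H L H)`, where
`K i j = kR (rᵢ, rⱼ)`, `L i j = kZ (zᵢ, zⱼ)` and `H i j = δ i j - 1 / n`. -/
def hsicHat {S : Type*} (kR : ℝ → ℝ → ℝ) (kZ : S → S → ℝ) {n : ℕ}
    (r : Fin n → ℝ) (z : Fin n → S) : ℝ :=
  let K : Matrix (Fin n) (Fin n) ℝ := Matrix.of fun i j => kR (r i) (r j)
  let L : Matrix (Fin n) (Fin n) ℝ := Matrix.of fun i j => kZ (z i) (z j)
  let H : Matrix (Fin n) (Fin n) ℝ := 1 - Matrix.of fun _ _ => 1 / (n : ℝ)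
  (K * H * L * H).trace

/-- The objective `f ↦ HSIC^((yᵢ - f(xᵢ), zᵢ)ᵢ; kR, kZ)` on a data set. -/
def hsicObjective {d r : ℕ} (kR : ℝ → ℝ → ℝ) (kZ : RV r → RV r → ℝ) {n : ℕ}
    (D : Fin n → Obs d r) (f : RV d → ℝ) : ℝ :=
  hsicHat kR kZ (fun i => (D i).2.1 - f (D i).1) (fun i => (D i).2.2)

/-- `a` is a minimizer of `F` over `A`. -/
def IsArgmin {T : Type*} (F : T → ℝ) (A : Set T) (a : T) : Prop :=
  a ∈ A ∧ ∀ b ∈ A, F a ≤ F b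

end

/-!
Both parts are argmin consistency. On the compact set `Θ`, a uniformly equicontinuous family of
random criteria that converges pointwise in probability converges uniformly in probability
(a finite net suffices, so no measurability of suprema is needed), hence its minimizers approach the
unique zero of the nonnegative continuous limit (`tendsto_measure_le_dist_argmin`). Identifiability,
applied to `τ = θ₀ - θ`, says that `θ₀` is the only parameter whose residual is independent of the
instruments (`IVModel.Identifiable.indepFun_iff`), so the limit has exactly one zero. As `φ` is
bounded, convergence of the parameters gives convergence of the functions in the supremum norm.

For HSIC, write the kernels as Gram kernels of feature maps `Φ`, `Ψ` into Hilbert spaces. Then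
`n⁻² trace (K H L H)` is the squared norm of the empirical cross-covariance
`n⁻¹ ∑ Φ(Rᵢ) ⊗ Ψ(Zᵢ) - (n⁻¹ ∑ Φ(Rᵢ)) ⊗ (n⁻¹ ∑ Ψ(Zᵢ))` in the Hilbert tensor product (`hsicHat_eq`),
and the strong law of large numbers in Hilbert spaces replaces any analysis of V-statistics
(`tendsto_empCrossCov`). The criteria are equicontinuous because a kernel with bounded derivative
has a uniformly continuous feature map.

The limit, the squared norm of the population cross-covariance, vanishes exactly under independence
(`crossCov_eq_zero_iff_indepFun`). If it vanishes, all kernel sections `kR(R, x)`, `kZ(Z, y)` are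
uncorrelated. Reweighting by an affine function of `kZ(Z, y)` then leaves the mean embedding of the
law of `R` unchanged, so `kZ(Z, y)` is uncorrelated with every event `R ∈ A`, as `kR` is
characteristic; therefore conditioning on `R ∈ A` leaves the mean embedding of the law of `Z`
unchanged, and `kZ` is characteristic too.
-/

/-! ### Argmin consistency on a compact set -/

/-- Pointwise convergence in probability of uniformly equicontinuous random functions to a
continuous limit is uniform on compact sets. -/
lemma tendsto_measure_exists_le_abs_sub {Ω T : Type*} [MeasurableSpace Ω] [PseudoMetricSpace T]
    (P : Measure Ω) {Θ : Set T} (hΘ : IsCompact Θ) {h : T → ℝ} (hh : ContinuousOn h Θ)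
    {Hn : ℕ → Ω → T → ℝ}
    (hequi : ∀ ε > 0, ∃ δ > 0, ∀ n ω, ∀ a ∈ Θ, ∀ b ∈ Θ, dist a b < δ → |Hn n ω a - Hn n ω b| < ε)
    (hlim : ∀ θ ∈ Θ, TendstoInMeasure P (fun n ω => Hn n ω θ) atTop (fun _ => h θ))
    {ε : ℝ} (hε : 0 < ε) :
    Tendsto (fun n => P {ω | ∃ θ ∈ Θ, ε ≤ |Hn n ω θ - h θ|}) atTop (𝓝 0) := by
  obtain ⟨δ₁, hδ₁, h₁⟩ := hequi (ε / 3) (by positivity)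
  obtain ⟨δ₂, hδ₂, h₂⟩ := Metric.uniformContinuousOn_iff.1
    (hΘ.uniformContinuousOn_of_continuous hh) (ε / 3) (by positivity)
  obtain ⟨t, htΘ, htfin, htcov⟩ := hΘ.finite_cover_balls (lt_min hδ₁ hδ₂)
  -- a deviation of `ε` anywhere forces a deviation of `ε / 3` at a point of the finite net
  have hsub : ∀ n, P {ω | ∃ θ ∈ Θ, ε ≤ |Hn n ω θ - h θ|} ≤
      ∑ s ∈ htfin.toFinset, P {ω | ENNReal.ofReal (ε / 3) ≤ edist (Hn n ω s) (h s)} := by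
    intro n
    refine (measure_mono ?_).trans (measure_biUnion_finset_le _ _)
    rintro ω ⟨θ, hθ, hle⟩
    obtain ⟨s, hs, hθs⟩ := Set.mem_iUnion₂.1 (htcov hθ)
    have hd : dist θ s < min δ₁ δ₂ := hθs
    have e₁ := h₁ n ω θ hθ s (htΘ hs) (hd.trans_le (min_le_left _ _))
    have e₂ := h₂ θ hθ s (htΘ hs) (hd.trans_le (min_le_right _ _))
    rw [Real.dist_eq] at e₂
    refine Set.mem_iUnion₂.2 ⟨s, htfin.mem_toFinset.2 hs, ?_⟩
    rw [Set.mem_ofPred_eq, edist_dist, Real.dist_eq]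
    apply ENNReal.ofReal_le_ofReal
    have e₃ : |Hn n ω θ - h θ| ≤
        |Hn n ω θ - Hn n ω s| + |Hn n ω s - h s| + |h θ - h s| := by
      rw [abs_sub_comm (h θ)]
      have := abs_add_three (Hn n ω θ - Hn n ω s) (Hn n ω s - h s) (h s - h θ)
      rwa [show Hn n ω θ - Hn n ω s + (Hn n ω s - h s) + (h s - h θ) = Hn n ω θ - h θ by ring]
        at this
    linarith
  refine tendsto_of_tendsto_of_tendsto_of_le_of_le tendsto_const_nhds ?_ (fun _ => zero_le) hsub
  rw [← Finset.sum_const_zero (s := htfin.toFinset)]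
  refine tendsto_finsetSum _ fun s hs => ?_
  exact hlim s (htΘ (htfin.mem_toFinset.1 hs)) _ (ENNReal.ofReal_pos.2 (by positivity))

/-- Minimizers of uniformly equicontinuous random functions on a compact set are consistent for
the unique zero of the nonnegative pointwise limit in probability. -/
lemma tendsto_measure_le_dist_argmin {Ω T : Type*} [MeasurableSpace Ω] [PseudoMetricSpace T]
    (P : Measure Ω) {Θ : Set T} (hΘ : IsCompact Θ) {θ₀ : T} (hθ₀ : θ₀ ∈ Θ)
    {h : T → ℝ} (hh : ContinuousOn h Θ) (h0 : h θ₀ = 0)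
    (hpos : ∀ θ ∈ Θ, θ ≠ θ₀ → 0 < h θ) {Hn : ℕ → Ω → T → ℝ}
    (hequi : ∀ ε > 0, ∃ δ > 0, ∀ n ω, ∀ a ∈ Θ, ∀ b ∈ Θ, dist a b < δ → |Hn n ω a - Hn n ω b| < ε)
    (hlim : ∀ θ ∈ Θ, TendstoInMeasure P (fun n ω => Hn n ω θ) atTop (fun _ => h θ))
    {θhat : ℕ → Ω → T} (hmin : ∀ n ω, IsArgmin (Hn n ω) Θ (θhat n ω))
    {ε : ℝ} (hε : 0 < ε) :
    Tendsto (fun n => P {ω | ε ≤ dist (θhat n ω) θ₀}) atTop (𝓝 0) := by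
  have hK : IsCompact (Θ ∩ {θ | ε ≤ dist θ θ₀}) :=
    hΘ.inter_right (isClosed_le continuous_const (by fun_prop))
  have hne : ∀ θ, ε ≤ dist θ θ₀ → θ ≠ θ₀ := by
    rintro θ hθ rfl
    rw [dist_self] at hθ
    exact absurd hθ (not_le.2 hε)
  -- `h` is bounded below by some `c > 0` outside the `ε`-ball around its zero
  obtain ⟨c, hc, hcK⟩ : ∃ c > 0, ∀ θ ∈ Θ, ε ≤ dist θ θ₀ → c ≤ h θ := by
    rcases (Θ ∩ {θ | ε ≤ dist θ θ₀}).eq_empty_or_nonempty with he | hn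
    · refine ⟨1, one_pos, fun θ hθ hd => ?_⟩
      have : θ ∈ Θ ∩ {θ | ε ≤ dist θ θ₀} := ⟨hθ, hd⟩
      simp [he] at this
    · obtain ⟨a, ha, hamin⟩ := hK.exists_isMinOn hn (hh.mono Set.inter_subset_left)
      exact ⟨h a, hpos a ha.1 (hne a ha.2), fun θ hθ hd => hamin ⟨hθ, hd⟩⟩
  refine tendsto_of_tendsto_of_tendsto_of_le_of_le tendsto_const_nhds
    (tendsto_measure_exists_le_abs_sub P hΘ hh hequi hlim (half_pos hc)) (fun _ => zero_le)
    fun n => measure_mono ?_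
  intro ω hω
  by_contra hcon
  simp only [Set.mem_ofPred_eq, not_exists, not_and, not_le] at hcon
  have e₁ := abs_lt.1 (hcon _ (hmin n ω).1)
  have e₂ := abs_lt.1 (hcon _ hθ₀)
  have e₃ := (hmin n ω).2 θ₀ hθ₀
  have e₄ := hcK _ (hmin n ω).1 hω
  linarith [e₁.1, e₂.2]

lemma exists_isArgmin {T : Type*} [TopologicalSpace T] {Θ : Set T} (hΘ : IsCompact Θ)
    (hne : Θ.Nonempty) {F : T → ℝ} (hF : ContinuousOn F Θ) : ∃ θ, IsArgmin F Θ θ := by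
  obtain ⟨a, ha, hmin⟩ := hΘ.exists_isMinOn hne hF
  exact ⟨a, ha, fun b hb => hmin hb⟩

/-- For bounded features, consistency in the parameter implies consistency of the linear functions
in the supremum norm. -/
lemma supConsistent_linFun {d p : ℕ} {Ω : Type*} [MeasurableSpace Ω] {P : Measure Ω}
    {φ : RV d → RV p} (hφ : ∃ C : ℝ, ∀ x, ‖φ x‖ ≤ C) {θhat : ℕ → Ω → RV p} {θ₀ : RV p}
    (h : ∀ ε : ℝ, 0 < ε → Tendsto (fun n => P {ω | ε ≤ dist (θhat n ω) θ₀}) atTop (𝓝 0)) :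
    SupConsistent P (fun n ω => linFun φ (θhat n ω)) (linFun φ θ₀) := by
  obtain ⟨C, hC⟩ := hφ
  have hC0 : 0 ≤ C := (norm_nonneg _).trans (hC 0)
  intro ε hε
  refine tendsto_of_tendsto_of_tendsto_of_le_of_le tendsto_const_nhds
    (h (ε / (C + 1)) (by positivity)) (fun _ => zero_le) fun n => measure_mono ?_
  intro ω (hω : ENNReal.ofReal ε ≤ supDist _ _)
  have hb : supDist (linFun φ (θhat n ω)) (linFun φ θ₀) ≤
      ENNReal.ofReal ((C + 1) * dist (θhat n ω) θ₀) := by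
    refine iSup_le fun x => ENNReal.ofReal_le_ofReal ?_
    rw [linFun, linFun, ← inner_sub_right, dist_eq_norm]
    refine (abs_real_inner_le_norm _ _).trans ?_
    gcongr
    linarith [hC x]
  rw [Set.mem_ofPred_eq, div_le_iff₀' (by positivity)]
  exact (ENNReal.ofReal_le_ofReal_iff (by positivity)).1 (hω.trans hb)

/-! ### Feature maps of kernels -/

universe u v

/-- Moore's theorem: a positive definite kernel is the Gram kernel of a feature map into a Hilbert
space. -/
lemma IsPDKernel.exists_feature {S : Type u} {k : S → S → ℝ} (hk : IsPDKernel k) :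
    ∃ (E : Type u) (_ : NormedAddCommGroup E) (_ : InnerProductSpace ℝ E) (_ : CompleteSpace E)
      (Φ : S → E), ∀ x y, inner ℝ (Φ x) (Φ y) = k x y := by
  let K : Matrix S S (ℝ →L[ℝ] ℝ) := Matrix.of fun x y => k x y • 1
  have hsymm : ∀ x y, k x y = k y x := fun x y => by
    have := congrFun (congrFun hk.1 y) x
    simpa [Matrix.conjTranspose_apply] using this
  have hK : K.PosSemidef := by
    have hherm : K.IsHermitian := by
      ext x y
      simp [K, hsymm x y, Matrix.conjTranspose_apply]
    have htfae := (RKHS.posSemidef_tfae (𝕜 := ℝ) (K := K)).out 0 2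
    refine htfae.2 ⟨hherm, fun v => ?_⟩
    have := hk.2 v
    simp only [RCLike.re_to_real]
    convert! this using 4
    simp [K]
    refine Finsupp.sum_congr fun j _ => ?_
    rw [hsymm j]
    ring
  have : Fact K.PosSemidef := ⟨hK⟩
  refine ⟨RKHS.OfKernel K, inferInstance, inferInstance, inferInstance,
    fun x => RKHS.kerFun (RKHS.OfKernel K) x 1, fun x y => ?_⟩
  have := RKHS.kernel_inner (H := RKHS.OfKernel K) y x 1 1
  rw [RKHS.OfKernel.kernel_ofKernel] at this
  rw [← this, hsymm x y]
  simp [K]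

open TensorProduct in
/-- The completed tensor product of two inner product spaces, described by its defining bilinear
map. -/
lemma exists_hilbertTensor (E : Type u) (F : Type v) [NormedAddCommGroup E] [InnerProductSpace ℝ E]
    [NormedAddCommGroup F] [InnerProductSpace ℝ F] :
    ∃ (T : Type (max u v)) (_ : NormedAddCommGroup T) (_ : InnerProductSpace ℝ T)
      (_ : CompleteSpace T) (B : E →L[ℝ] F →L[ℝ] T),
      ∀ a a' b b', inner ℝ (B a b) (B a' b') = inner ℝ a a' * inner ℝ b b' := by
  refine ⟨UniformSpace.Completion (E ⊗[ℝ] F), inferInstance, inferInstance, inferInstance,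
    (ContinuousLinearMap.compL ℝ F (E ⊗[ℝ] F) _ UniformSpace.Completion.toComplL).comp
      (TensorProduct.mkL ℝ E F), fun a a' b b' => ?_⟩
  simp [UniformSpace.Completion.inner_coe]

lemma norm_feature_sub_sq_le {S E : Type*} [NormedAddCommGroup E] [InnerProductSpace ℝ E]
    {k : S → S → ℝ} {Φ : S → E} (hΦ : ∀ x y, inner ℝ (Φ x) (Φ y) = k x y) (x y : S) :
    ‖Φ x - Φ y‖ ^ 2 = (k x x - k x y) + (k y y - k y x) := by
  rw [← real_inner_self_eq_norm_sq, inner_sub_left, inner_sub_right, inner_sub_right]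
  simp only [hΦ]
  ring

lemma continuous_feature {S E : Type*} [TopologicalSpace S] [NormedAddCommGroup E]
    [InnerProductSpace ℝ E] {k : S → S → ℝ} (hk : Continuous fun v : S × S => k v.1 v.2)
    {Φ : S → E} (hΦ : ∀ x y, inner ℝ (Φ x) (Φ y) = k x y) : Continuous Φ := by
  refine continuous_iff_continuousAt.2 fun y => ?_
  rw [ContinuousAt, tendsto_iff_norm_sub_tendsto_zero]
  have h1 : Continuous fun x => √((k x x - k x y) + (k y y - k y x)) := by
    have e1 : Continuous fun x => k x x := hk.comp (continuous_id.prodMk continuous_id)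
    have e2 : Continuous fun x => k x y := hk.comp (continuous_id.prodMk continuous_const)
    have e3 : Continuous fun x => k y x := hk.comp (continuous_const.prodMk continuous_id)
    fun_prop
  have h2 := h1.tendsto y
  simp only [sub_self, add_zero, Real.sqrt_zero] at h2
  refine h2.congr fun x => ?_
  rw [← norm_feature_sub_sq_le hΦ, Real.sqrt_sq (norm_nonneg _)]

/-- The feature map of a kernel with bounded derivative is uniformly continuous: it is even
`1/2`-Hölder, since `‖Φ x - Φ y‖²` is a difference of kernel values. -/
lemma IsAdmissibleKernel.uniformContinuous_feature {S E : Type*} [NormedAddCommGroup S]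
    [NormedSpace ℝ S] [MeasurableSpace S] [NormedAddCommGroup E] [InnerProductSpace ℝ E]
    {k : S → S → ℝ} (hk : IsAdmissibleKernel k)
    {Φ : S → E} (hΦ : ∀ x y, inner ℝ (Φ x) (Φ y) = k x y) : UniformContinuous Φ := by
  obtain ⟨C, hC⟩ := hk.deriv_bounded
  have hC0 : 0 ≤ C := (norm_nonneg _).trans (hC 0)
  have hlip : ∀ v w : S × S, |k v.1 v.2 - k w.1 w.2| ≤ C * ‖v - w‖ := fun v w =>
    convex_univ.norm_image_sub_le_of_norm_fderiv_le (𝕜 := ℝ)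
      (f := fun v : S × S => k v.1 v.2)
      (fun x _ => (hk.contDiff.differentiable one_ne_zero) x) (fun x _ => hC x)
      (Set.mem_univ w) (Set.mem_univ v)
  refine Metric.uniformContinuous_iff.2 fun ε hε => ⟨ε ^ 2 / (2 * C + 1), by positivity, ?_⟩
  intro x y hxy
  rw [dist_eq_norm] at hxy ⊢
  rw [lt_div_iff₀ (by positivity)] at hxy
  refine lt_of_pow_lt_pow_left₀ 2 hε.le ?_
  rw [norm_feature_sub_sq_le hΦ]
  have h1 := (le_abs_self _).trans (hlip (x, x) (x, y))
  have h2 := (le_abs_self _).trans (hlip (y, y) (y, x))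
  simp only [Prod.mk_sub_mk, sub_self, Prod.norm_mk, norm_zero, norm_nonneg, sup_of_le_right] at h1 h2
  rw [norm_sub_rev y x] at h2
  nlinarith [norm_nonneg (x - y)]

lemma IsAdmissibleKernel.exists_norm_feature_le {S E : Type*} [NormedAddCommGroup S]
    [NormedSpace ℝ S] [MeasurableSpace S] [NormedAddCommGroup E] [InnerProductSpace ℝ E]
    {k : S → S → ℝ} (hk : IsAdmissibleKernel k)
    {Φ : S → E} (hΦ : ∀ x y, inner ℝ (Φ x) (Φ y) = k x y) : ∃ C, 0 ≤ C ∧ ∀ x, ‖Φ x‖ ≤ C := by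
  obtain ⟨C, hC⟩ := hk.bounded
  refine ⟨√C, Real.sqrt_nonneg _, fun x => Real.le_sqrt_of_sq_le ?_⟩
  rw [← real_inner_self_eq_norm_sq, hΦ]
  exact (le_abs_self _).trans (hC x x)

/-! ### Empirical and population cross-covariance -/

section CrossCov

variable {E F T : Type*} [NormedAddCommGroup E] [InnerProductSpace ℝ E]
  [NormedAddCommGroup F] [InnerProductSpace ℝ F] [NormedAddCommGroup T] [InnerProductSpace ℝ T]

/-- The empirical cross-covariance of two samples in Hilbert spaces, as an element of their tensor
product, where `B a b` stands for `a ⊗ b`. For `n = 0` it is `0`. -/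
noncomputable def empCrossCov (B : E →L[ℝ] F →L[ℝ] T) {n : ℕ} (a : Fin n → E) (b : Fin n → F) : T :=
  (n : ℝ)⁻¹ • ∑ i, B (a i) (b i) - B ((n : ℝ)⁻¹ • ∑ i, a i) ((n : ℝ)⁻¹ • ∑ i, b i)

/-- The population cross-covariance of two Hilbert space valued random variables, where `B a b`
stands for `a ⊗ b`. -/
noncomputable def crossCov (B : E →L[ℝ] F →L[ℝ] T) {Ω : Type*} [MeasurableSpace Ω] (μ : Measure Ω)
    (a : Ω → E) (b : Ω → F) : T :=
  ∫ ω, B (a ω) (b ω) ∂μ - B (∫ ω, a ω ∂μ) (∫ ω, b ω ∂μ)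

variable {B : E →L[ℝ] F →L[ℝ] T}

lemma norm_tensor (hB : ∀ a a' b b', inner ℝ (B a b) (B a' b') = inner ℝ a a' * inner ℝ b b')
    (a : E) (b : F) : ‖B a b‖ = ‖a‖ * ‖b‖ := by
  rw [← sq_eq_sq₀ (by positivity) (by positivity), mul_pow]
  simp only [← real_inner_self_eq_norm_sq, hB]

/-- Centring only the second sample gives the cross-covariance up to the factor `n`. -/
lemma sum_tensor_sub_mean (B : E →L[ℝ] F →L[ℝ] T) {n : ℕ} (a : Fin n → E) (b : Fin n → F) :
    ∑ i, B (a i) (b i - (n : ℝ)⁻¹ • ∑ j, b j) = (n : ℝ) • empCrossCov B a b := by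
  rcases Nat.eq_zero_or_pos n with rfl | hn
  · simp
  have hn' : (n : ℝ) ≠ 0 := by positivity
  simp only [empCrossCov, map_sub, Finset.sum_sub_distrib, smul_sub]
  rw [smul_inv_smul₀ hn', map_smul B, smul_apply, smul_inv_smul₀ hn', map_sum B,
    sum_apply]

/-- The biased HSIC estimator is the squared Hilbert-Schmidt norm of the empirical
cross-covariance of the features. -/
lemma hsicHat_eq {S : Type*} {kR : ℝ → ℝ → ℝ} {kZ : S → S → ℝ} {Φ : ℝ → E} {Ψ : S → F}
    (hΦ : ∀ x y, inner ℝ (Φ x) (Φ y) = kR x y) (hΨ : ∀ x y, inner ℝ (Ψ x) (Ψ y) = kZ x y)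
    (hB : ∀ a a' b b', inner ℝ (B a b) (B a' b') = inner ℝ a a' * inner ℝ b b')
    {n : ℕ} (r : Fin n → ℝ) (z : Fin n → S) :
    hsicHat kR kZ r z = (n : ℝ) ^ 2 * ‖empCrossCov B (Φ ∘ r) (Ψ ∘ z)‖ ^ 2 := by
  have hcenter : ∀ (i : Fin n) (g : Fin n → F),
      ∑ k, ((1 - Matrix.of fun _ _ => 1 / (n : ℝ) : Matrix (Fin n) (Fin n) ℝ) i k) • g k =
        g i - (n : ℝ)⁻¹ • ∑ j, g j := by
    intro i g
    simp [sub_smul, Finset.sum_sub_distrib, Matrix.one_apply, Finset.smul_sum]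
  set b : Fin n → F := fun i => Ψ (z i) - (n : ℝ)⁻¹ • ∑ j, Ψ (z j) with hb
  have hsym : ∀ i j, (1 - Matrix.of fun _ _ => 1 / (n : ℝ) : Matrix (Fin n) (Fin n) ℝ) i j =
      (1 - Matrix.of fun _ _ => 1 / (n : ℝ) : Matrix (Fin n) (Fin n) ℝ) j i := by
    intro i j
    simp [Matrix.one_apply, eq_comm]
  have hHLH : ∀ i j, ((1 - Matrix.of fun _ _ => 1 / (n : ℝ)) *
      (Matrix.of fun i j => kZ (z i) (z j)) * (1 - Matrix.of fun _ _ => 1 / (n : ℝ)) :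
        Matrix (Fin n) (Fin n) ℝ) i j = inner ℝ (b i) (b j) := by
    intro i j
    simp only [hb]
    rw [← hcenter i (fun i => Ψ (z i)), ← hcenter j (fun i => Ψ (z i)), inner_sum]
    rw [Matrix.mul_apply]
    refine Finset.sum_congr rfl fun l _ => ?_
    rw [Matrix.mul_apply, inner_smul_right, sum_inner, hsym l j, mul_comm]
    congr 1
    refine Finset.sum_congr rfl fun k _ => ?_
    rw [inner_smul_left, hΨ]
    simp
  have hmain : hsicHat kR kZ r z = ∑ i, ∑ j, kR (r i) (r j) * inner ℝ (b j) (b i) := by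
    simp only [hsicHat]
    rw [Matrix.mul_assoc, Matrix.mul_assoc, ← Matrix.mul_assoc (1 - _)]
    simp only [Matrix.trace, Matrix.diag, Matrix.mul_apply (M := Matrix.of _), hHLH,
      Matrix.of_apply]
  rw [hmain, ← Real.norm_natCast n, ← mul_pow, ← norm_smul, ← sum_tensor_sub_mean,
    ← real_inner_self_eq_norm_sq, sum_inner]
  refine Finset.sum_congr rfl fun i _ => ?_
  rw [inner_sum]
  refine Finset.sum_congr rfl fun j _ => ?_
  rw [hB, real_inner_comm (b i)]
  simp only [Function.comp_apply, hΦ, hb]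

lemma norm_mean_le {n : ℕ} {G : Type*} [NormedAddCommGroup G] [NormedSpace ℝ G] {a : Fin n → G}
    {C : ℝ} (hC0 : 0 ≤ C) (ha : ∀ i, ‖a i‖ ≤ C) : ‖(n : ℝ)⁻¹ • ∑ i, a i‖ ≤ C := by
  rcases Nat.eq_zero_or_pos n with rfl | hn
  · simpa using hC0
  rw [norm_smul, norm_inv, Real.norm_natCast, inv_mul_le_iff₀ (by positivity)]
  refine (norm_sum_le _ _).trans ((Finset.sum_le_sum fun i _ => ha i).trans ?_)
  simp

lemma norm_empCrossCov_le
    (hB : ∀ a a' b b', inner ℝ (B a b) (B a' b') = inner ℝ a a' * inner ℝ b b')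
    {n : ℕ} {a : Fin n → E} {b : Fin n → F} {C C' : ℝ} (hC0 : 0 ≤ C) (hC0' : 0 ≤ C')
    (ha : ∀ i, ‖a i‖ ≤ C) (hb : ∀ i, ‖b i‖ ≤ C') : ‖empCrossCov B a b‖ ≤ 2 * (C * C') := by
  have h1 : ‖(n : ℝ)⁻¹ • ∑ i, B (a i) (b i)‖ ≤ C * C' :=
    norm_mean_le (by positivity) fun i => by
      rw [norm_tensor hB]
      exact mul_le_mul (ha i) (hb i) (norm_nonneg _) hC0
  have h2 : ‖B ((n : ℝ)⁻¹ • ∑ i, a i) ((n : ℝ)⁻¹ • ∑ i, b i)‖ ≤ C * C' := by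
    rw [norm_tensor hB]
    exact mul_le_mul (norm_mean_le hC0 ha) (norm_mean_le hC0' hb) (norm_nonneg _) hC0
  refine (norm_sub_le _ _).trans ?_
  linarith

lemma empCrossCov_sub_left (B : E →L[ℝ] F →L[ℝ] T) {n : ℕ} (a a' : Fin n → E) (b : Fin n → F) :
    empCrossCov B a b - empCrossCov B a' b = empCrossCov B (a - a') b := by
  simp only [empCrossCov, Pi.sub_apply, map_sub, sub_apply,
    Finset.sum_sub_distrib, smul_sub]
  abel

lemma abs_norm_empCrossCov_sq_sub_le
    (hB : ∀ a a' b b', inner ℝ (B a b) (B a' b') = inner ℝ a a' * inner ℝ b b')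
    {n : ℕ} {a a' : Fin n → E} {b : Fin n → F} {C C' δ : ℝ} (hC0 : 0 ≤ C) (hC0' : 0 ≤ C')
    (hδ : 0 ≤ δ) (ha : ∀ i, ‖a i‖ ≤ C) (ha' : ∀ i, ‖a' i‖ ≤ C) (hb : ∀ i, ‖b i‖ ≤ C')
    (h : ∀ i, ‖a i - a' i‖ ≤ δ) :
    |‖empCrossCov B a b‖ ^ 2 - ‖empCrossCov B a' b‖ ^ 2| ≤ 8 * C * C' ^ 2 * δ := by
  have h1 := norm_empCrossCov_le hB hC0 hC0' ha hb
  have h2 := norm_empCrossCov_le hB hC0 hC0' ha' hb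
  have h3 : |‖empCrossCov B a b‖ - ‖empCrossCov B a' b‖| ≤ 2 * (δ * C') := by
    refine (abs_norm_sub_norm_le _ _).trans ?_
    rw [empCrossCov_sub_left]
    exact norm_empCrossCov_le hB hδ hC0' h hb
  rw [sq_sub_sq, abs_mul, abs_of_nonneg (by positivity)]
  calc _ ≤ (2 * (C * C') + 2 * (C * C')) * (2 * (δ * C')) :=
        mul_le_mul (add_le_add h1 h2) h3 (abs_nonneg _) (by positivity)
    _ = _ := by ring

lemma empCrossCov_eq_range (B : E →L[ℝ] F →L[ℝ] T) (n : ℕ) (a : ℕ → E) (b : ℕ → F) :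
    empCrossCov B (fun i : Fin n => a i) (fun i : Fin n => b i) =
      (n : ℝ)⁻¹ • ∑ i ∈ Finset.range n, B (a i) (b i) -
        B ((n : ℝ)⁻¹ • ∑ i ∈ Finset.range n, a i) ((n : ℝ)⁻¹ • ∑ i ∈ Finset.range n, b i) := by
  simp only [empCrossCov, Finset.sum_range]

end CrossCov

/-! ### Vanishing cross-covariance and independence -/

section Independence

variable {Ω S₁ S₂ : Type*} [MeasurableSpace Ω] [MeasurableSpace S₁] [MeasurableSpace S₂]

/-- If the sections of a bounded characteristic kernel at `V` are uncorrelated with a bounded random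
variable `g`, then `g` is uncorrelated with every event `V ∈ A`: after an affine change `g` is a
probability density, and reweighting by it does not change the mean embedding of the law of `V`. -/
lemma integral_indicator_eq_of_isCharacteristic (μ : Measure Ω) [IsProbabilityMeasure μ]
    {k : S₁ → S₁ → ℝ} (hk : IsCharacteristic k) (hkm : ∀ y, Measurable fun x => k x y)
    (hkb : ∃ C : ℝ, ∀ x y, |k x y| ≤ C) {V : Ω → S₁} (hV : Measurable V) {g : Ω → ℝ}
    (hg : Measurable g) (hgb : ∃ C : ℝ, ∀ ω, |g ω| ≤ C)
    (huncorr : ∀ y, ∫ ω, k (V ω) y * g ω ∂μ = (∫ ω, k (V ω) y ∂μ) * ∫ ω, g ω ∂μ)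
    {A : Set S₁} (hA : MeasurableSet A) :
    ∫ ω in V ⁻¹' A, g ω ∂μ = μ.real (V ⁻¹' A) * ∫ ω, g ω ∂μ := by
  obtain ⟨C, hC⟩ := hgb
  obtain ⟨C₁, hC₁⟩ := hkb
  have hgi : Integrable g μ := Integrable.of_bound hg.aestronglyMeasurable C
    (ae_of_all _ fun ω => (Real.norm_eq_abs _).trans_le (hC ω))
  set m := ∫ ω, g ω ∂μ with hm
  have hmC : |m| ≤ C := by
    have := norm_integral_le_of_norm_le_const (μ := μ) (f := g)
      (ae_of_all _ fun ω => (Real.norm_eq_abs _).trans_le (hC ω))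
    simpa using this
  have hD : 0 < m + C + 1 := by linarith [(abs_le.1 hmC).1]
  have hw0 : ∀ ω, 0 ≤ (g ω + C + 1) / (m + C + 1) := fun ω =>
    div_nonneg (by linarith [(abs_le.1 (hC ω)).1]) hD.le
  let w : Ω → ℝ≥0 := fun ω => ⟨(g ω + C + 1) / (m + C + 1), hw0 ω⟩
  have hw : Measurable w := Measurable.subtype_mk (by fun_prop)
  have hint : ∀ f : Ω → ℝ, ∫ ω, f ω ∂μ.withDensity (fun ω => (w ω : ℝ≥0∞)) =
      ∫ ω, (g ω + C + 1) / (m + C + 1) * f ω ∂μ := fun f =>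
    integral_withDensity_eq_integral_smul hw f
  -- the affine change of `g` integrates products as it should
  have hexp : ∀ f : Ω → ℝ, Integrable f μ → Integrable (fun ω => f ω * g ω) μ →
      ∫ ω, (g ω + C + 1) / (m + C + 1) * f ω ∂μ =
        (∫ ω, f ω * g ω ∂μ + (C + 1) * ∫ ω, f ω ∂μ) / (m + C + 1) := by
    intro f hf hfg
    rw [← integral_const_mul, ← integral_add hfg (hf.const_mul _), ← integral_div]
    congr 1 with ω
    ring
  have hprod : ∀ f : Ω → ℝ, Integrable f μ → Integrable (fun ω => f ω * g ω) μ := fun f hf =>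
    hf.mul_bdd hg.aestronglyMeasurable
      (ae_of_all _ fun ω => (Real.norm_eq_abs _).trans_le (hC ω))
  have hfin : ∫⁻ ω, w ω ∂μ = 1 := by
    have h1 : ∫ ω, (w ω : ℝ) ∂μ = 1 := by
      have := hexp (fun _ => 1) (integrable_const _) (hprod _ (integrable_const _))
      simp only [mul_one, one_mul, integral_const, probReal_univ, smul_eq_mul] at this
      rw [show (∫ ω, (w ω : ℝ) ∂μ) = _ from this, ← hm, div_eq_one_iff_eq hD.ne']
      ring
    have h2 := ofReal_integral_eq_lintegral_ofReal (μ := μ) (f := fun ω => (w ω : ℝ))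
      (by
        have : Integrable (fun ω => (g ω + C + 1) / (m + C + 1)) μ := by fun_prop
        exact this)
      (ae_of_all _ fun ω => (w ω).2)
    rw [h1, ENNReal.ofReal_one] at h2
    rw [h2]
    simp
  have hprobw : IsProbabilityMeasure (μ.withDensity fun ω => (w ω : ℝ≥0∞)) := ⟨by
    rw [withDensity_apply _ MeasurableSet.univ, Measure.restrict_univ, hfin]⟩
  have hki : ∀ y, Integrable (fun ω => k (V ω) y) μ := fun y =>
    Integrable.of_bound ((hkm y).comp hV).aestronglyMeasurable C₁ (ae_of_all _ fun ω => hC₁ _ _)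
  have heq : (μ.withDensity fun ω => (w ω : ℝ≥0∞)).map V = μ.map V := by
    refine hk _ _ (Measure.isProbabilityMeasure_map hV.aemeasurable)
      (Measure.isProbabilityMeasure_map hV.aemeasurable) fun y => ?_
    rw [integral_map hV.aemeasurable (hkm y).aestronglyMeasurable,
      integral_map hV.aemeasurable (hkm y).aestronglyMeasurable, hint,
      hexp _ (hki y) (hprod _ (hki y)), huncorr, div_eq_iff hD.ne']
    ring
  have hfinal : ∫ ω, (V ⁻¹' A).indicator 1 ω ∂μ.withDensity (fun ω => (w ω : ℝ≥0∞)) =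
      μ.real (V ⁻¹' A) := by
    rw [integral_indicator_one (hV hA), measureReal_def, measureReal_def,
      ← Measure.map_apply hV hA, ← Measure.map_apply hV hA, heq]
  have hAi : Integrable ((V ⁻¹' A).indicator (1 : Ω → ℝ)) μ :=
    (integrable_const (1 : ℝ)).indicator (hV hA)
  rw [hint, hexp _ hAi (hprod _ hAi), integral_indicator_one (hV hA), div_eq_iff hD.ne'] at hfinal
  have hmul : (fun ω => (V ⁻¹' A).indicator (1 : Ω → ℝ) ω * g ω) = (V ⁻¹' A).indicator g := by
    ext ω
    by_cases h : ω ∈ V ⁻¹' A <;> simp [h]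
  rw [hmul, integral_indicator (hV hA)] at hfinal
  linarith

/-- If all sections of two bounded characteristic kernels are uncorrelated, the random variables
are independent. -/
lemma indepFun_of_isCharacteristic (μ : Measure Ω) [IsProbabilityMeasure μ]
    {k₁ : S₁ → S₁ → ℝ} {k₂ : S₂ → S₂ → ℝ} (hk₁ : IsCharacteristic k₁) (hk₂ : IsCharacteristic k₂)
    (hm₁ : ∀ y, Measurable fun x => k₁ x y) (hm₂ : ∀ y, Measurable fun x => k₂ x y)
    (hb₁ : ∃ C : ℝ, ∀ x y, |k₁ x y| ≤ C) (hb₂ : ∃ C : ℝ, ∀ x y, |k₂ x y| ≤ C)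
    {V : Ω → S₁} {W : Ω → S₂} (hV : Measurable V) (hW : Measurable W)
    (huncorr : ∀ x y, ∫ ω, k₁ (V ω) x * k₂ (W ω) y ∂μ =
      (∫ ω, k₁ (V ω) x ∂μ) * ∫ ω, k₂ (W ω) y ∂μ) : IndepFun V W μ := by
  rw [indepFun_iff_measure_inter_preimage_eq_mul]
  intro A A' hA hA'
  by_cases h0 : μ (V ⁻¹' A) = 0
  · rw [h0, zero_mul]
    exact measure_mono_null Set.inter_subset_left h0
  have := cond_isProbabilityMeasure (μ := μ) h0
  have hreal : μ.real (V ⁻¹' A) ≠ 0 := by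
    rwa [Ne, measureReal_eq_zero_iff]
  have heq : (μ[|V ⁻¹' A]).map W = μ.map W := by
    refine hk₂ _ _ (Measure.isProbabilityMeasure_map hW.aemeasurable)
      (Measure.isProbabilityMeasure_map hW.aemeasurable) fun y => ?_
    rw [integral_map hW.aemeasurable (hm₂ y).aestronglyMeasurable,
      integral_map hW.aemeasurable (hm₂ y).aestronglyMeasurable]
    have h := integral_indicator_eq_of_isCharacteristic μ hk₁ hm₁ hb₁ hV
      (g := fun ω => k₂ (W ω) y) ((hm₂ y).comp hW)
      (by obtain ⟨C, hC⟩ := hb₂; exact ⟨C, fun ω => hC _ _⟩) (fun x => huncorr x y) hA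
    rw [ProbabilityTheory.cond, integral_smul_measure, h, ENNReal.toReal_inv, ← measureReal_def, smul_eq_mul,
      inv_mul_cancel_left₀ hreal]
  have h1 : μ[|V ⁻¹' A] (W ⁻¹' A') = μ (W ⁻¹' A') := by
    rw [← Measure.map_apply hW hA', heq, Measure.map_apply hW hA']
  rw [cond_apply (hV hA)] at h1
  rw [← h1, ENNReal.mul_inv_cancel_left h0 (measure_ne_top _ _)]

variable {E F T : Type*} [NormedAddCommGroup E] [InnerProductSpace ℝ E]
  [NormedAddCommGroup F] [InnerProductSpace ℝ F]
  [NormedAddCommGroup T] [InnerProductSpace ℝ T] {B : E →L[ℝ] F →L[ℝ] T}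

lemma integrable_tensor (B : E →L[ℝ] F →L[ℝ] T) {μ : Measure Ω} [IsFiniteMeasure μ]
    {a : Ω → E} {b : Ω → F} {C C' : ℝ} (ha : AEStronglyMeasurable a μ)
    (hb : AEStronglyMeasurable b μ) (haC : ∀ ω, ‖a ω‖ ≤ C) (hbC : ∀ ω, ‖b ω‖ ≤ C') :
    Integrable (fun ω => B (a ω) (b ω)) μ := by
  refine Integrable.of_bound (B.aestronglyMeasurable_comp₂ ha hb) (‖B‖ * C * C')
    (ae_of_all _ fun ω => (B.le_opNorm₂ _ _).trans ?_)
  have hC := (norm_nonneg _).trans (haC ω)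
  exact mul_le_mul (mul_le_mul_of_nonneg_left (haC ω) (norm_nonneg B)) (hbC ω) (norm_nonneg _)
    (by positivity)

/-- The Hilbert-Schmidt independence criterion: for bounded characteristic kernels, the
cross-covariance of the features vanishes exactly under independence. -/
lemma crossCov_eq_zero_iff_indepFun [CompleteSpace E] [CompleteSpace F] [CompleteSpace T] {μ : Measure Ω} [IsProbabilityMeasure μ]
    {k₁ : S₁ → S₁ → ℝ} {k₂ : S₂ → S₂ → ℝ} (hk₁ : IsCharacteristic k₁) (hk₂ : IsCharacteristic k₂)
    {Φ : S₁ → E} {Ψ : S₂ → F} (hΦ : ∀ x y, inner ℝ (Φ x) (Φ y) = k₁ x y)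
    (hΨ : ∀ x y, inner ℝ (Ψ x) (Ψ y) = k₂ x y)
    (hB : ∀ a a' b b', inner ℝ (B a b) (B a' b') = inner ℝ a a' * inner ℝ b b')
    (hΦm : StronglyMeasurable Φ) (hΨm : StronglyMeasurable Ψ)
    {C C' : ℝ} (hΦC : ∀ x, ‖Φ x‖ ≤ C) (hΨC : ∀ x, ‖Ψ x‖ ≤ C')
    {V : Ω → S₁} {W : Ω → S₂} (hV : Measurable V) (hW : Measurable W) :
    crossCov B μ (Φ ∘ V) (Ψ ∘ W) = 0 ↔ IndepFun V W μ := by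
  have hC0 : 0 ≤ C := (norm_nonneg _).trans (hΦC (V (Classical.choice μ.nonempty_of_neZero)))
  have hC0' : 0 ≤ C' := (norm_nonneg _).trans (hΨC (W (Classical.choice μ.nonempty_of_neZero)))
  have hiV : Integrable (fun ω => Φ (V ω)) μ :=
    Integrable.of_bound (hΦm.comp_measurable hV).aestronglyMeasurable C (ae_of_all _ fun _ => hΦC _)
  have hiW : Integrable (fun ω => Ψ (W ω)) μ :=
    Integrable.of_bound (hΨm.comp_measurable hW).aestronglyMeasurable C'
      (ae_of_all _ fun _ => hΨC _)
  have hiVW : Integrable (fun ω => B (Φ (V ω)) (Ψ (W ω))) μ :=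
    integrable_tensor B hiV.1 hiW.1 (fun _ => hΦC _) (fun _ => hΨC _)
  constructor
  · intro h
    refine indepFun_of_isCharacteristic μ hk₁ hk₂ (fun y => ?_) (fun y => ?_) ⟨C * C, fun x y => ?_⟩
      ⟨C' * C', fun x y => ?_⟩ hV hW fun x y => ?_
    · simp only [← hΦ]
      exact (hΦm.inner stronglyMeasurable_const).measurable
    · simp only [← hΨ]
      exact (hΨm.inner stronglyMeasurable_const).measurable
    · rw [← hΦ]
      exact (abs_real_inner_le_norm _ _).trans
        (mul_le_mul (hΦC _) (hΦC _) (norm_nonneg _) hC0)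
    · rw [← hΨ]
      exact (abs_real_inner_le_norm _ _).trans
        (mul_le_mul (hΨC _) (hΨC _) (norm_nonneg _) hC0')
    -- the covariance of two kernel sections is an inner product with the cross-covariance
    · have h1 : inner ℝ (B (Φ x) (Ψ y)) (crossCov B μ (Φ ∘ V) (Ψ ∘ W)) = 0 := by
        rw [h, inner_zero_right]
      simp only [crossCov, Function.comp_def] at h1
      rw [inner_sub_right, hB, ← integral_inner hiVW, ← integral_inner hiV,
        ← integral_inner hiW, sub_eq_zero] at h1
      simp only [hB, hΦ, hΨ] at h1
      have s₁ : ∀ u v, k₁ u v = k₁ v u := fun u v => by rw [← hΦ, real_inner_comm, hΦ]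
      have s₂ : ∀ u v, k₂ u v = k₂ v u := fun u v => by rw [← hΨ, real_inner_comm, hΨ]
      simp only [s₁ x, s₂ y] at h1
      exact h1
  · intro h
    rw [crossCov, sub_eq_zero]
    have hmap := (indepFun_iff_map_prod_eq_prod_map_map hV.aemeasurable hW.aemeasurable).1 h
    have := Measure.isProbabilityMeasure_map (μ := μ) hV.aemeasurable
    have := Measure.isProbabilityMeasure_map (μ := μ) hW.aemeasurable
    have hprod : StronglyMeasurable fun v : S₁ × S₂ => B (Φ v.1) (Ψ v.2) := by
      have e1 := hΦm.comp_measurable (measurable_fst : Measurable (Prod.fst : S₁ × S₂ → S₁))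
      have e2 := hΨm.comp_measurable (measurable_snd : Measurable (Prod.snd : S₁ × S₂ → S₂))
      exact (B.continuous₂).comp_stronglyMeasurable (e1.prodMk e2)
    have hΦi : Integrable Φ (μ.map V) :=
      Integrable.of_bound hΦm.aestronglyMeasurable C (ae_of_all _ hΦC)
    have hΨi : Integrable Ψ (μ.map W) :=
      Integrable.of_bound hΨm.aestronglyMeasurable C' (ae_of_all _ hΨC)
    calc ∫ ω, B ((Φ ∘ V) ω) ((Ψ ∘ W) ω) ∂μ
        = ∫ v, B (Φ v.1) (Ψ v.2) ∂(μ.map fun ω => (V ω, W ω)) :=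
          (integral_map (hV.prodMk hW).aemeasurable hprod.aestronglyMeasurable).symm
      _ = ∫ x, ∫ y, B (Φ x) (Ψ y) ∂(μ.map W) ∂(μ.map V) := by
          rw [hmap, integral_prod]
          exact integrable_tensor B (a := fun v : S₁ × S₂ => Φ v.1) (b := fun v => Ψ v.2)
            (hΦm.comp_measurable measurable_fst).aestronglyMeasurable
            (hΨm.comp_measurable measurable_snd).aestronglyMeasurable
            (fun _ => hΦC _) (fun _ => hΨC _)
      _ = ∫ x, B.flip (∫ y, Ψ y ∂(μ.map W)) (Φ x) ∂(μ.map V) := by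
          congr 1 with x
          exact (B (Φ x)).integral_comp_comm hΨi
      _ = B (∫ x, Φ x ∂(μ.map V)) (∫ y, Ψ y ∂(μ.map W)) :=
          (B.flip _).integral_comp_comm hΦi
      _ = _ := by
          rw [integral_map hV.aemeasurable hΦm.aestronglyMeasurable,
            integral_map hW.aemeasurable hΨm.aestronglyMeasurable]
          rfl

end Independence

/-! ### Consistency of the empirical cross-covariance -/

section LawOfLargeNumbers

variable {Ω S : Type*} [MeasurableSpace Ω] [MeasurableSpace S] {P : Measure Ω}
  [IsProbabilityMeasure P] {μ : Measure S} {D : ℕ → Ω → S}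

/-- The strong law of large numbers for a bounded function of i.i.d. observations. -/
lemma tendsto_mean_of_iid {G : Type*} [NormedAddCommGroup G] [NormedSpace ℝ G] [CompleteSpace G]
    (hlaw : ∀ i, HasLaw (D i) μ P) (hindep : iIndepFun D P) {a : S → G} (ha : StronglyMeasurable a)
    {C : ℝ} (hC : ∀ s, ‖a s‖ ≤ C) :
    ∀ᵐ ω ∂P, Tendsto (fun n : ℕ => (n : ℝ)⁻¹ • ∑ i ∈ Finset.range n, a (D i ω)) atTop
      (𝓝 (∫ s, a s ∂μ)) := by
  borelize G
  have hint : Integrable (a ∘ D 0) P := by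
    refine Integrable.of_bound ?_ C (ae_of_all _ fun _ => hC _)
    exact ha.aestronglyMeasurable.comp_aemeasurable (hlaw 0).aemeasurable
  have h := strong_law_ae (fun i => a ∘ D i) hint
    (fun i j hij => (hindep.indepFun hij).comp ha.measurable ha.measurable)
    (fun i => ((hlaw i).identDistrib (hlaw 0)).comp ha.measurable)
  rwa [(hlaw 0).integral_comp ha.aestronglyMeasurable] at h

variable {E F T : Type*} [NormedAddCommGroup E] [InnerProductSpace ℝ E]
  [NormedAddCommGroup F] [InnerProductSpace ℝ F]
  [NormedAddCommGroup T] [InnerProductSpace ℝ T]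

lemma tendsto_empCrossCov [CompleteSpace E] [CompleteSpace F] [CompleteSpace T]
    (B : E →L[ℝ] F →L[ℝ] T) (hlaw : ∀ i, HasLaw (D i) μ P)
    (hindep : iIndepFun D P) {a : S → E} {b : S → F} (ha : StronglyMeasurable a)
    (hb : StronglyMeasurable b) {C C' : ℝ} (hC : ∀ s, ‖a s‖ ≤ C) (hC' : ∀ s, ‖b s‖ ≤ C') :
    ∀ᵐ ω ∂P, Tendsto (fun n : ℕ => empCrossCov B (fun i : Fin n => a (D i ω))
      (fun i : Fin n => b (D i ω))) atTop (𝓝 (crossCov B μ a b)) := by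
  have hBm : StronglyMeasurable fun s => B (a s) (b s) :=
    B.continuous₂.comp_stronglyMeasurable (ha.prodMk hb)
  have hBC : ∀ s, ‖B (a s) (b s)‖ ≤ ‖B‖ * C * C' := fun s => by
    have h0 := (norm_nonneg _).trans (hC s)
    exact (B.le_opNorm₂ _ _).trans (mul_le_mul (mul_le_mul_of_nonneg_left (hC s) (norm_nonneg B))
      (hC' s) (norm_nonneg _) (by positivity))
  filter_upwards [tendsto_mean_of_iid hlaw hindep ha hC, tendsto_mean_of_iid hlaw hindep hb hC',
    tendsto_mean_of_iid hlaw hindep hBm hBC] with ω h1 h2 h3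
  simp only [empCrossCov_eq_range B _ (fun i => a (D i ω)) (fun i => b (D i ω))]
  exact h3.sub ((B.continuous₂.tendsto _).comp (h1.prodMk_nhds h2))

lemma tendstoInMeasure_norm_empCrossCov_sq [CompleteSpace E] [CompleteSpace F] [CompleteSpace T]
    (B : E →L[ℝ] F →L[ℝ] T) (hlaw : ∀ i, HasLaw (D i) μ P)
    (hindep : iIndepFun D P) {a : S → E} {b : S → F} (ha : StronglyMeasurable a)
    (hb : StronglyMeasurable b) {C C' : ℝ} (hC : ∀ s, ‖a s‖ ≤ C) (hC' : ∀ s, ‖b s‖ ≤ C') :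
    TendstoInMeasure P (fun n ω => ‖empCrossCov B (fun i : Fin n => a (D i ω))
      (fun i : Fin n => b (D i ω))‖ ^ 2) atTop (fun _ => ‖crossCov B μ a b‖ ^ 2) := by
  refine tendstoInMeasure_of_tendsto_ae (fun n => ?_) ?_
  · have h1 : ∀ i, AEStronglyMeasurable (fun ω => a (D i ω)) P := fun i =>
      ha.aestronglyMeasurable.comp_aemeasurable (hlaw i).aemeasurable
    have h2 : ∀ i, AEStronglyMeasurable (fun ω => b (D i ω)) P := fun i =>
      hb.aestronglyMeasurable.comp_aemeasurable (hlaw i).aemeasurable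
    refine AEStronglyMeasurable.pow (AEStronglyMeasurable.norm ?_) 2
    rw [funext fun ω => empCrossCov_eq_range B n (fun i => a (D i ω)) (fun i => b (D i ω))]
    refine AEStronglyMeasurable.sub (AEStronglyMeasurable.const_smul ?_ _)
      (B.aestronglyMeasurable_comp₂ (AEStronglyMeasurable.const_smul ?_ _)
        (AEStronglyMeasurable.const_smul ?_ _))
    · exact Finset.aestronglyMeasurable_fun_sum _ fun i _ =>
        B.aestronglyMeasurable_comp₂ (h1 i) (h2 i)
    · exact Finset.aestronglyMeasurable_fun_sum _ fun i _ => h1 i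
    · exact Finset.aestronglyMeasurable_fun_sum _ fun i _ => h2 i
  · filter_upwards [tendsto_empCrossCov B hlaw hindep ha hb hC hC'] with ω h
    exact h.norm.pow 2

end LawOfLargeNumbers

lemma continuous_crossCov {S A E F T : Type*} [MeasurableSpace S] {μ : Measure S}
    [IsFiniteMeasure μ] [TopologicalSpace A] [FirstCountableTopology A]
    [NormedAddCommGroup E] [InnerProductSpace ℝ E]
    [NormedAddCommGroup F] [InnerProductSpace ℝ F]
    [NormedAddCommGroup T] [InnerProductSpace ℝ T] (B : E →L[ℝ] F →L[ℝ] T)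
    {a : A → S → E} {b : S → F} (ha : ∀ θ, StronglyMeasurable (a θ)) (hb : StronglyMeasurable b)
    {C C' : ℝ} (hC : ∀ θ s, ‖a θ s‖ ≤ C) (hC' : ∀ s, ‖b s‖ ≤ C')
    (hcont : ∀ s, Continuous fun θ => a θ s) : Continuous fun θ => crossCov B μ (a θ) b := by
  have h1 : Continuous fun θ => ∫ s, B (a θ s) (b s) ∂μ := by
    refine continuous_of_dominated (bound := fun _ => ‖B‖ * C * C')
      (fun θ => (B.aestronglyMeasurable_comp₂ (ha θ).aestronglyMeasurable hb.aestronglyMeasurable))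
      (fun θ => ae_of_all _ fun s => ?_) (integrable_const _) (ae_of_all _ fun s => ?_)
    · have h0 := (norm_nonneg _).trans (hC θ s)
      exact (B.le_opNorm₂ _ _).trans (mul_le_mul
        (mul_le_mul_of_nonneg_left (hC θ s) (norm_nonneg B)) (hC' s) (norm_nonneg _)
        (by positivity))
    · exact (B.flip (b s)).continuous.comp (hcont s)
  have h2 : Continuous fun θ => ∫ s, a θ s ∂μ :=
    continuous_of_dominated (bound := fun _ => C) (fun θ => (ha θ).aestronglyMeasurable)
      (fun θ => ae_of_all _ fun s => hC θ s) (integrable_const _) (ae_of_all _ hcont)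
  exact h1.sub ((B.flip (∫ s, b s ∂μ)).continuous.comp h2)

/-! ### The IV model -/

/-- The ivResidual `y - φ(x)ᵀ θ` of an observation `(x, y, z)`. -/
noncomputable def ivResidual {d r p : ℕ} (φ : RV d → RV p) (θ : RV p) (s : Obs d r) : ℝ :=
  s.2.1 - inner ℝ (φ s.1) θ

lemma measurable_ivResidual {d r p : ℕ} {φ : RV d → RV p} (hφ : Measurable φ) (θ : RV p) :
    Measurable (ivResidual (r := r) φ θ) := by
  have h : Measurable fun s : Obs d r => inner ℝ (φ s.1) θ :=
    (hφ.comp measurable_fst).inner measurable_const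
  unfold ivResidual
  fun_prop

lemma abs_ivResidual_sub_le {d r p : ℕ} {φ : RV d → RV p} {C : ℝ} (hC : ∀ x, ‖φ x‖ ≤ C)
    (θ θ' : RV p) (s : Obs d r) : |ivResidual φ θ s - ivResidual φ θ' s| ≤ C * dist θ θ' := by
  rw [ivResidual, ivResidual, sub_sub_sub_cancel_left, ← inner_sub_right, dist_comm, dist_eq_norm]
  exact (abs_real_inner_le_norm _ _).trans
    (mul_le_mul_of_nonneg_right (hC _) (norm_nonneg _))

lemma hsicObjective_linFun {d r p : ℕ} (kR : ℝ → ℝ → ℝ) (kZ : RV r → RV r → ℝ) {n : ℕ}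
    (data : Fin n → Obs d r) (φ : RV d → RV p) (θ : RV p) :
    hsicObjective kR kZ data (linFun φ θ) =
      hsicHat kR kZ (fun i => ivResidual φ θ (data i)) (fun i => (data i).2.2) :=
  rfl

namespace IVModel

variable {d r q p : ℕ} {NX NY : Type*} [MeasurableSpace NX] [MeasurableSpace NY]
  (M : IVModel d r q NX NY)

instance isProbabilityMeasure_Q : IsProbabilityMeasure M.Q := by
  have := M.isProb_QZ
  have := M.isProb_QU
  have := M.isProb_QX
  have := M.isProb_QY
  unfold Q
  infer_instance

lemma measurable_X : Measurable M.X := by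
  have := M.measurable_g
  unfold X
  fun_prop

lemma measurable_hUY : Measurable M.hUY := by
  have := M.measurable_h
  unfold hUY
  fun_prop

lemma measurable_obs : Measurable fun e => (M.X e, M.Y e, M.Z e) :=
  M.measurable_X.prodMk
    (((M.measurable_f.comp M.measurable_X).add M.measurable_hUY).prodMk measurable_fst)

instance isProbabilityMeasure_obsLaw : IsProbabilityMeasure M.obsLaw :=
  Measure.isProbabilityMeasure_map M.measurable_obs.aemeasurable

/-- The instruments are independent of the noise term of the response. -/
lemma indepFun_Z_hUY : IndepFun M.Z M.hUY M.Q := by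
  have := M.isProb_QZ
  have := M.isProb_QU
  have := M.isProb_QX
  have := M.isProb_QY
  have hh : Measurable fun e : RV q × NX × NY => M.h (e.1, e.2.2) := by
    have := M.measurable_h
    fun_prop
  exact indepFun_prod (μ := M.QZ) (ν := M.QU.prod (M.QX.prod M.QY)) measurable_id hh

variable {M} {φ : RV d → RV p} {θ₀ : RV p}

/-- Under identifiability, `θ₀` is the only parameter with residual independent of the
instruments. -/
lemma Identifiable.indepFun_iff (hident : M.Identifiable φ) (hf : M.f = linFun φ θ₀) (θ : RV p) :
    IndepFun (fun e => M.Y e - inner ℝ (φ (M.X e)) θ) M.Z M.Q ↔ θ = θ₀ := by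
  have hY : (fun e => M.Y e - inner ℝ (φ (M.X e)) θ) =
      fun e => M.hUY e + inner ℝ (φ (M.X e)) (θ₀ - θ) := by
    ext e
    rw [Y, hf, linFun, inner_sub_right]
    ring
  rw [hY]
  constructor
  · intro h
    exact (sub_eq_zero.1 (hident _ h.symm)).symm
  · rintro rfl
    simpa using M.indepFun_Z_hUY.symm

lemma Identifiable.indepFun_obsLaw_iff (hident : M.Identifiable φ) (hf : M.f = linFun φ θ₀)
    (hφ : Measurable φ) (θ : RV p) :
    IndepFun (ivResidual φ θ) (fun s => s.2.2) M.obsLaw ↔ θ = θ₀ := by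
  rw [← hident.indepFun_iff hf θ, indepFun_iff_measure_inter_preimage_eq_mul,
    indepFun_iff_measure_inter_preimage_eq_mul]
  have hr := measurable_ivResidual (r := r) hφ θ
  have hz : Measurable fun s : Obs d r => s.2.2 := by fun_prop
  refine forall₄_congr fun A A' hA hA' => ?_
  rw [obsLaw, Measure.map_apply M.measurable_obs ((hr hA).inter (hz hA')),
    Measure.map_apply M.measurable_obs (hr hA), Measure.map_apply M.measurable_obs (hz hA')]
  rfl

end IVModel

/-! ### Consistency of the HSIC estimator -/

/-- The normalized HSIC objective is uniformly equicontinuous in the parameter, over all sample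
sizes and data sets. -/
lemma equicontinuous_norm_empCrossCov_sq {d r p : ℕ} {E F T : Type*} [NormedAddCommGroup E]
    [InnerProductSpace ℝ E] [NormedAddCommGroup F] [InnerProductSpace ℝ F] [NormedAddCommGroup T]
    [InnerProductSpace ℝ T] {B : E →L[ℝ] F →L[ℝ] T}
    (hB : ∀ a a' b b', inner ℝ (B a b) (B a' b') = inner ℝ a a' * inner ℝ b b')
    {φ : RV d → RV p} (hφ : ∃ C : ℝ, ∀ x, ‖φ x‖ ≤ C) {Φ : ℝ → E} {Ψ : RV r → F}
    (hΦ : UniformContinuous Φ) {C C' : ℝ} (hC0 : 0 ≤ C) (hC0' : 0 ≤ C') (hC : ∀ x, ‖Φ x‖ ≤ C)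
    (hC' : ∀ x, ‖Ψ x‖ ≤ C') {ε : ℝ} (hε : 0 < ε) :
    ∃ δ > 0, ∀ (n : ℕ) (data : Fin n → Obs d r) (θ θ' : RV p), dist θ θ' < δ →
      |‖empCrossCov B (Φ ∘ fun i => ivResidual φ θ (data i)) (Ψ ∘ fun i => (data i).2.2)‖ ^ 2 -
        ‖empCrossCov B (Φ ∘ fun i => ivResidual φ θ' (data i)) (Ψ ∘ fun i => (data i).2.2)‖ ^ 2|
          < ε := by
  obtain ⟨K, hK⟩ := hφ
  have hK0 : 0 ≤ K := (norm_nonneg _).trans (hK 0)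
  set η := ε / (8 * C * C' ^ 2 + 1) with hη
  have hη0 : 0 < η := by positivity
  obtain ⟨ρ, hρ, hΦρ⟩ := Metric.uniformContinuous_iff.1 hΦ η hη0
  refine ⟨ρ / (K + 1), by positivity, fun n data θ θ' hθ => ?_⟩
  rw [lt_div_iff₀ (by positivity)] at hθ
  refine (abs_norm_empCrossCov_sq_sub_le hB hC0 hC0' hη0.le (fun _ => hC _) (fun _ => hC _)
    (fun _ => hC' _) fun i => ?_).trans_lt ?_
  · rw [← dist_eq_norm]
    refine (hΦρ ?_).le
    rw [Real.dist_eq]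
    refine (abs_ivResidual_sub_le hK θ θ' _).trans_lt ?_
    nlinarith [dist_nonneg (x := θ) (y := θ')]
  · have : η * (8 * C * C' ^ 2 + 1) = ε := div_mul_cancel₀ _ (by positivity)
    linarith

theorem theorem1 {d r q p : ℕ} {NX NY Ω : Type*} [MeasurableSpace NX] [MeasurableSpace NY]
    [MeasurableSpace Ω]
    -- the IV model, with causal function `f⁰ = φᵀ θ⁰`
    (M : IVModel d r q NX NY)
    (φ : RV d → RV p) (hφ_meas : Measurable φ) (hφ_bdd : ∃ C : ℝ, ∀ x, ‖φ x‖ ≤ C)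
    (Θ : Set (RV p)) (hΘ : IsCompact Θ) (θ₀ : RV p) (hθ₀ : θ₀ ∈ Θ) (hf : M.f = linFun φ θ₀)
    (hident : M.Identifiable φ)
    -- i.i.d. observations
    (P : Measure Ω) [IsProbabilityMeasure P] (D : ℕ → Ω → Obs d r)
    (hlaw : ∀ i, HasLaw (D i) M.obsLaw P) (hindep : iIndepFun D P) :
    -- consistency of the HSIC minimizer
    (∀ (kR : ℝ → ℝ → ℝ) (kZ : RV r → RV r → ℝ),
      IsAdmissibleKernel kR → IsAdmissibleKernel kZ →
        (∀ (n : ℕ) (data : Fin n → Obs d r),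
          ∃ f, IsArgmin (hsicObjective kR kZ data) (funClass φ Θ) f) ∧
        ∀ fhat : ℕ → Ω → RV d → ℝ,
          (∀ n ω, IsArgmin (hsicObjective kR kZ (sample D n ω)) (funClass φ Θ) (fhat n ω)) →
            SupConsistent P fhat M.f) ∧
    -- general independence measures
    (∀ (H : Measure (Obs d r) → RV p → ℝ)
      (Hhat : (n : ℕ) → (Fin n → Obs d r) → RV p → ℝ) (L : ℝ≥0),
      (∀ θ ∈ Θ, 0 ≤ H M.obsLaw θ) →
      (∀ θ ∈ Θ, H M.obsLaw θ = 0 ↔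
        IndepFun (fun e => M.Y e - inner ℝ (φ (M.X e)) θ) M.Z M.Q) →
      (∀ θ ∈ Θ, TendstoInMeasure P (fun n ω => Hhat n (sample D n ω) θ) atTop
        (fun _ => H M.obsLaw θ)) →
      LipschitzOnWith L (H M.obsLaw) Θ →
      (∀ n data, LipschitzOnWith L (Hhat n data) Θ) →
        (∀ (n : ℕ) (data : Fin n → Obs d r), ∃ θ, IsArgmin (Hhat n data) Θ θ) ∧
        ∀ θhat : ℕ → Ω → RV p,
          (∀ n ω, IsArgmin (Hhat n (sample D n ω)) Θ (θhat n ω)) →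
            SupConsistent P (fun n ω => linFun φ (θhat n ω)) M.f) := by
  refine ⟨fun kR kZ hkR hkZ => ?_, fun H Hhat L hH0 hHiff hHlim hHlip hHhatlip =>
    ⟨fun n data => exists_isArgmin hΘ ⟨θ₀, hθ₀⟩ (hHhatlip n data).continuousOn,
      fun θhat hmin => ?_⟩⟩
  · obtain ⟨E, _, _, _, Φ, hΦ⟩ := hkR.posDef.exists_feature
    obtain ⟨F, _, _, _, Ψ, hΨ⟩ := hkZ.posDef.exists_feature
    obtain ⟨T, _, _, _, B, hB⟩ := exists_hilbertTensor E F
    obtain ⟨C, hC0, hC⟩ := hkR.exists_norm_feature_le hΦ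
    obtain ⟨C', hC0', hC'⟩ := hkZ.exists_norm_feature_le hΨ
    have hΦu := hkR.uniformContinuous_feature hΦ
    have hΦm : StronglyMeasurable Φ := hΦu.continuous.stronglyMeasurable
    have hΨm : StronglyMeasurable Ψ :=
      (continuous_feature hkZ.contDiff.continuous hΨ).stronglyMeasurable
    have hz : Measurable fun s : Obs d r => s.2.2 := by fun_prop
    have hequi := fun {ε : ℝ} (hε : 0 < ε) =>
      equicontinuous_norm_empCrossCov_sq (d := d) hB hφ_bdd hΦu hC0 hC0' hC hC' hε
    -- `trace (K H L H)` is `n²` times the normalized objective; this also holds for `n = 0`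
    let G : (n : ℕ) → (Fin n → Obs d r) → RV p → ℝ := fun n data θ =>
      ‖empCrossCov B (Φ ∘ fun i => ivResidual φ θ (data i)) (Ψ ∘ fun i => (data i).2.2)‖ ^ 2
    have hobj : ∀ (n : ℕ) (data : Fin n → Obs d r) θ,
        hsicObjective kR kZ data (linFun φ θ) = (n : ℝ) ^ 2 * G n data θ := fun n data θ => by
      rw [hsicObjective_linFun, hsicHat_eq hΦ hΨ hB]
    refine ⟨fun n data => ?_, fun fhat hmin => ?_⟩
    · have hcont : Continuous (G n data) := by
        refine Metric.continuous_iff.2 fun θ ε hε => ?_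
        obtain ⟨δ, hδ, h⟩ := hequi hε
        exact ⟨δ, hδ, fun θ' hθ' => h n data θ' θ hθ'⟩
      obtain ⟨θ, hθ, hmin⟩ := exists_isArgmin hΘ ⟨θ₀, hθ₀⟩ hcont.continuousOn
      refine ⟨linFun φ θ, ⟨θ, hθ, rfl⟩, ?_⟩
      rintro _ ⟨θ', hθ', rfl⟩
      rw [hobj, hobj]
      exact mul_le_mul_of_nonneg_left (hmin θ' hθ') (by positivity)
    · choose θhat hθhat hfhat using fun n ω => (hmin n ω).1
      obtain rfl : fhat = fun n ω => linFun φ (θhat n ω) := by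
        ext1 n
        ext1 ω
        exact hfhat n ω
      rw [hf]
      refine supConsistent_linFun hφ_bdd fun ε hε => ?_
      refine tendsto_measure_le_dist_argmin P hΘ hθ₀
        (h := fun θ => ‖crossCov B M.obsLaw (Φ ∘ ivResidual φ θ) (Ψ ∘ fun s => s.2.2)‖ ^ 2)
        (Hn := fun n ω => G n (sample D n ω)) ?_ ?_ ?_ ?_ ?_ ?_ hε
      · refine ((continuous_crossCov B (a := fun θ => Φ ∘ ivResidual φ θ)
          (fun θ => hΦm.comp_measurable (measurable_ivResidual hφ_meas θ))
          (hΨm.comp_measurable hz) (fun _ _ => hC _) (fun _ => hC' _)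
          fun s => hΦu.continuous.comp ?_).norm.pow 2).continuousOn
        unfold ivResidual
        fun_prop
      · rw [(crossCov_eq_zero_iff_indepFun hkR.characteristic hkZ.characteristic hΦ hΨ hB hΦm hΨm
          hC hC' (measurable_ivResidual hφ_meas _) hz).2
            ((hident.indepFun_obsLaw_iff hf hφ_meas _).2 rfl)]
        simp
      · intro θ _ hne
        refine pow_pos (norm_pos_iff.2 fun h0 => hne ?_) 2
        exact (hident.indepFun_obsLaw_iff hf hφ_meas _).1
          ((crossCov_eq_zero_iff_indepFun hkR.characteristic hkZ.characteristic hΦ hΨ hB hΦm hΨm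
            hC hC' (measurable_ivResidual hφ_meas _) hz).1 h0)
      · intro ε hε
        obtain ⟨δ, hδ, h⟩ := hequi hε
        exact ⟨δ, hδ, fun n ω a _ b _ hab => h n _ a b hab⟩
      · intro θ _
        exact tendstoInMeasure_norm_empCrossCov_sq B (a := Φ ∘ ivResidual φ θ)
          (b := Ψ ∘ fun s => s.2.2) hlaw hindep
          (hΦm.comp_measurable (measurable_ivResidual hφ_meas θ)) (hΨm.comp_measurable hz)
          (fun _ => hC _) (fun _ => hC' _)
      · refine fun n ω => ⟨hθhat n ω, fun θ hθ => ?_⟩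
        rcases Nat.eq_zero_or_pos n with rfl | hn
        · simp [G, empCrossCov]
        · have h := (hmin n ω).2 _ ⟨θ, hθ, rfl⟩
          rw [hobj, hobj] at h
          exact le_of_mul_le_mul_left h (by positivity)
  · rw [hf]
    refine supConsistent_linFun hφ_bdd fun ε hε => ?_
    refine tendsto_measure_le_dist_argmin P hΘ hθ₀ (h := H M.obsLaw)
      (Hn := fun n ω => Hhat n (sample D n ω)) hHlip.continuousOn
      ((hHiff θ₀ hθ₀).2 ((hident.indepFun_iff hf θ₀).2 rfl)) (fun θ hθ hne => ?_)
      (fun ε hε => ?_) hHlim hmin hε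
    · refine lt_of_le_of_ne (hH0 θ hθ) fun h0 => hne ?_
      exact (hident.indepFun_iff hf θ).1 ((hHiff θ hθ).1 h0.symm)
    · refine ⟨ε / (L + 1), by positivity, fun n ω a ha b hb hab => ?_⟩
      rw [lt_div_iff₀ (by positivity)] at hab
      have h := (hHhatlip n (sample D n ω)).dist_le_mul a ha b hb
      rw [Real.dist_eq] at h
      nlinarith [dist_nonneg (x := a) (y := b)]
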